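/- Let $\ell\in\mathbb N$ and let $P$ be the transition kernel of a Markov chain on $\mathbb R^\ell$ with its Borel $\sigma$-field, with $P^t f(x)=\int f(y)\,P^t(x,dy)$. Let $v\colon\mathbb R^\ell\to[1,\infty)$ be continuous. Put $\|f\|_v=\sup_x |f(x)|/v(x)$, and let $L_\infty^v$ be the space of measurable $f\colon\mathbb R^\ell\to\mathbb R$ with $\|f\|_v<\infty$. Put $$\|f\|_{v,1}=\max\{\|f\|_v,\|\partial_1 f\|_v,\dots,\|\partial_\ell f\|_v\},$$ and let $L_\infty^{v,1}$ be the space of continuously differentiable $f$ with $\|f\|_{v,1}<\infty$. For a linear operator $A\colon L_\infty^{v,1}\to L_\infty^{v,1}$ put $$|||A|||_{v,1}=\sup\{\|Af\|_{v,1}/\|f\|_{v,1} : f\in L_\infty^{v,1},\ \|f\|_{v,1}\ne 0\};$$ the assertion $|||A|||_{v,1}<\infty$ includes that $A$ maps $L_\infty^{v,1}$ into itself. For a signed measure $\nu$ put $\|\nu\|_v=\sup\{|\nu(f)|/\|f\|_v : f\in L_\infty^v,\ \|f\|_v\neq 0\}$, where $\nu(f)=\int f\,d\nu$. An operator $A\colon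 L_\infty^{v,1}\to L_\infty^{v,1}$ is *separable* in $L_\infty^{v,1}$ if for each $\varepsilon>0$ there is a finite-rank operator $T=\sum_{i,j=1}^N m_{ij}\,s_i\otimes\nu_j$, i.e. $Tf=\sum_{i,j}m_{ij}\,\nu_j(f)\,s_i$, with $N<\infty$, $m_{ij}\in\mathbb R$, $s_i\in L_\infty^{v,1}$ and signed measures $\nu_j$ with $\|\nu_j\|_v<\infty$, such that $|||A-T|||_{v,1}\le\varepsilon$. Suppose that the chain is $v$-uniformly ergodic: there are a unique invariant probability measure $\pi$ and constants $b<\infty$, $0<\rho<1$ such that, for every $f\in L_\infty^v$ (the integrals existing), $$|P^t f(x)-\pi(f)|\le b\,\rho^t\,\|f\|_v\,v(x),\qquad t\ge 0,\ x\in\mathbb R^\ell .$$ Suppose also that for some integer $t_1\ge 1$ we have $|||P^t|||_{v,1}<\infty$ for all integers $t\ge t_1$, and that $P^{t_1}$ is separable in $L_\infty^{v,1}$. Then the following hold. (i) There are $b_0<\infty$ and $0<\varrho_0<1$ such that $|||P^t-1\otimes\pi|||_{v,1}\le b_0\varrho_0^t$ for all $t\ge t_1$, where $(1\otimes\pi)f=\pi(f)\cdot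 1$. (ii) If, in addition, $|||P^t|||_{v,1}<\infty$ for all $t\ge 1$, then for every $c\in L_\infty^{v,1}$ there is a solution $h\in L_\infty^{v,1}$ of Poisson's equation $h-Ph=c-\pi(c)$, whose gradient is given by the (absolutely convergent) series $$\nabla h(x)=\sum_{t=0}^\infty\nabla P^t c\,(x),\qquad x\in\mathbb R^\ell .$$ -/

import Mathlib

open MeasureTheory ProbabilityTheory
open scoped ENNReal

noncomputable section

namespace WeightedSobolev

/-- The state space `ℝ^ℓ`, with its Borel `σ`-field. -/
abbrev State (ℓ : ℕ) : Type := EuclideanSpace ℝ (Fin ℓ)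

variable {ℓ : ℕ}

/-- The weighted norm `‖f‖_v = sup_x |f x| / v x`, possibly infinite. -/
def vNorm (v : State ℓ → ℝ) (f : State ℓ → ℝ) : ℝ≥0∞ :=
  ⨆ x, ENNReal.ofReal (|f x| / v x)

/-- The space `L_∞^v` of measurable functions with `‖f‖_v < ∞`. -/
def Lv (v : State ℓ → ℝ) : Set (State ℓ → ℝ) :=
  {f | Measurable f ∧ vNorm v f < ⊤}

/-- The partial derivative `∂_i f`; it is only used for differentiable `f`. -/
def partialDeriv (i : Fin ℓ) (f : State ℓ → ℝ) (x : State ℓ) : ℝ :=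
  fderiv ℝ f x (EuclideanSpace.single i 1)

/-- The weighted Sobolev norm `‖f‖_{v,1} = max {‖f‖_v, ‖∂_1 f‖_v, …, ‖∂_ℓ f‖_v}`, possibly
infinite. -/
def sobNorm (v : State ℓ → ℝ) (f : State ℓ → ℝ) : ℝ≥0∞ :=
  max (vNorm v f) (⨆ i, vNorm v (partialDeriv i f))

/-- The weighted Sobolev space `L_∞^{v,1}`: the function and its first partial derivatives exist,
are continuous, and have finite `v`-norm. -/
def Lv1 (v : State ℓ → ℝ) : Set (State ℓ → ℝ) :=
  {f | ContDiff ℝ 1 f ∧ sobNorm v f < ⊤}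

/-- The induced operator norm `sup {‖A f‖_{v,1} / ‖f‖_{v,1} : f ∈ L_∞^{v,1}, ‖f‖_{v,1} ≠ 0}`, to be
used for `A` that maps `L_∞^{v,1}` into itself. -/
def opNorm (v : State ℓ → ℝ) (A : (State ℓ → ℝ) → (State ℓ → ℝ)) : ℝ≥0∞ :=
  ⨆ f ∈ {f | f ∈ Lv1 v ∧ sobNorm v f ≠ 0}, sobNorm v (A f) / sobNorm v f

/-- `A` acts as a bounded operator `L_∞^{v,1} → L_∞^{v,1}`, that is, its induced norm on this space
makes sense and is finite. -/
def IsBoundedOn (v : State ℓ → ℝ) (A : (State ℓ → ℝ) → (State ℓ → ℝ)) : Prop :=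
  Set.MapsTo A (Lv1 v) (Lv1 v) ∧ opNorm v A < ⊤

/-- The action `(P f)(x) = ∫ f(y) P(x, dy)` of a kernel on functions. -/
def kernelOp (P : Kernel (State ℓ) (State ℓ)) (f : State ℓ → ℝ) (x : State ℓ) : ℝ :=
  ∫ y, f y ∂(P x)

/-- The action of `P̃^t = P^t - 1 ⊗ π` on functions. -/
def centeredOp (P : Kernel (State ℓ) (State ℓ)) (π : Measure (State ℓ)) (t : ℕ)
    (f : State ℓ → ℝ) (x : State ℓ) : ℝ :=
  kernelOp (P ^ t) f x - ∫ y, f y ∂π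

/-- The integral `ν(f)` of a real function with respect to a signed measure. -/
def signedIntegral (ν : SignedMeasure (State ℓ)) (f : State ℓ → ℝ) : ℝ :=
  ν.integral f (ContinuousLinearMap.lsmul ℝ ℝ)

/-- The norm `‖ν‖_v = sup {|ν(f)| / ‖f‖_v : f ∈ L_∞^v, ‖f‖_v ≠ 0}` of a signed measure. -/
def signedVNorm (v : State ℓ → ℝ) (ν : SignedMeasure (State ℓ)) : ℝ≥0∞ :=
  ⨆ f ∈ {f | f ∈ Lv v ∧ vNorm v f ≠ 0}, ENNReal.ofReal |signedIntegral ν f| / vNorm v f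

/-- The space `M_1^v` of signed measures with `‖ν‖_v < ∞`. The first condition says that the
integrals `ν(f)`, `f ∈ L_∞^v`, in the definition of `‖ν‖_v` exist. -/
def M1v (v : State ℓ → ℝ) : Set (SignedMeasure (State ℓ)) :=
  {ν | (∀ f ∈ Lv v, ν.Integrable f) ∧ signedVNorm v ν < ⊤}

/-- The operator `T = ∑_{i,j} m_{ij} s_i ⊗ ν_j`, that is, `(T f)(x) = ∑_{i,j} m_{ij} s_i(x) ν_j(f)`.
-/
def finiteRankOp {N : ℕ} (m : Fin N → Fin N → ℝ) (s : Fin N → State ℓ → ℝ)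
    (ν : Fin N → SignedMeasure (State ℓ)) (f : State ℓ → ℝ) (x : State ℓ) : ℝ :=
  ∑ i, ∑ j, m i j * s i x * signedIntegral (ν j) f

/-- Finite-rank operators on `L_∞^{v,1}`. -/
def IsFiniteRank (v : State ℓ → ℝ) (T : (State ℓ → ℝ) → (State ℓ → ℝ)) : Prop :=
  ∃ (N : ℕ) (m : Fin N → Fin N → ℝ) (s : Fin N → State ℓ → ℝ)
    (ν : Fin N → SignedMeasure (State ℓ)),
    (∀ i, s i ∈ Lv1 v) ∧ (∀ j, ν j ∈ M1v v) ∧ T = finiteRankOp m s ν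

/-- `A` is separable in `L_∞^{v,1}`: it maps this space into itself and is a limit of finite-rank
operators in the induced operator norm. -/
def IsSeparableOp (v : State ℓ → ℝ) (A : (State ℓ → ℝ) → (State ℓ → ℝ)) : Prop :=
  Set.MapsTo A (Lv1 v) (Lv1 v) ∧
    ∀ ε : ℝ, 0 < ε → ∃ T, IsFiniteRank v T ∧
      opNorm v (fun f x => A f x - T f x) ≤ ENNReal.ofReal ε

/-- The chain with transition kernel `P` is `v`-uniformly ergodic, with unique invariant probability
measure `π`. The integrals `P^t f (x)` and `π(f)` are required to exist for `f ∈ L_∞^v`. -/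
structure IsVUniformlyErgodic (v : State ℓ → ℝ) (P : Kernel (State ℓ) (State ℓ))
    (π : Measure (State ℓ)) : Prop where
  isProbabilityMeasure : IsProbabilityMeasure π
  invariant : Kernel.Invariant P π
  unique : ∀ μ : Measure (State ℓ), IsProbabilityMeasure μ → Kernel.Invariant P μ → μ = π
  integrable : ∀ f ∈ Lv v, Integrable f π ∧ ∀ (t : ℕ) (x : State ℓ), Integrable f ((P ^ t) x)
  bound : ∃ b₀ ρ₀ : ℝ, 0 < ρ₀ ∧ ρ₀ < 1 ∧ ∀ f ∈ Lv v, ∀ (t : ℕ) (x : State ℓ),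
    |kernelOp (P ^ t) f x - ∫ y, f y ∂π| ≤ b₀ * ρ₀ ^ t * (vNorm v f).toReal * v x

end WeightedSobolev

end

noncomputable section

namespace WeightedSobolev

/-! ### Weighted norms as pointwise bounds. -/

section Norms

variable {ℓ : ℕ} {v : State ℓ → ℝ} {f g : State ℓ → ℝ} {M : ℝ}

/-! Write `Q_t = P^t - 1 ⊗ π`. A finite-rank `T` sees `f` only through the numbers `ν_j(f)`, so its
Sobolev norm is controlled by `‖f‖_v` alone. Separability therefore gives `‖P^{t₁} f‖_{v,1} ≤ ε
‖f‖_{v,1} + C_ε ‖f‖_v` for every `ε > 0` (`IsSeparableOp.exists_bound`). Apply this to `Q_s f`,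
using `Q_{s+t₁} f = P^{t₁} Q_s f`. Ergodicity makes the weak norm of `Q_s f` decay like `ρ^s`, and
`ε = ρ^{t₁}/2` lets induction carry the same rate `ρ` to the strong norm
(`exists_sobNorm_centeredOp_le`). No spectral theory is needed. For Poisson's equation, `h = ∑ Q_t
c` converges in the Sobolev norm and can be differentiated termwise; the constants `π(c)` vanish
from the gradients. -/

theorem vNorm_le_ofReal_iff (hv : ∀ x, 1 ≤ v x) (hM : 0 ≤ M) :
    vNorm v f ≤ ENNReal.ofReal M ↔ ∀ x, |f x| ≤ M * v x := by
  simp only [vNorm, iSup_le_iff, ENNReal.ofReal_le_ofReal_iff hM]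
  exact forall_congr' fun x => div_le_iff₀ (zero_lt_one.trans_le (hv x))

theorem sobNorm_le_ofReal_iff (hv : ∀ x, 1 ≤ v x) (hM : 0 ≤ M) :
    sobNorm v f ≤ ENNReal.ofReal M ↔
      (∀ x, |f x| ≤ M * v x) ∧ ∀ i x, |partialDeriv i f x| ≤ M * v x := by
  simp only [sobNorm, max_le_iff, iSup_le_iff, vNorm_le_ofReal_iff hv hM]

theorem bounds_of_mem_Lv1 (hv : ∀ x, 1 ≤ v x) (hf : f ∈ Lv1 v) :
    (∀ x, |f x| ≤ (sobNorm v f).toReal * v x) ∧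
      ∀ i x, |partialDeriv i f x| ≤ (sobNorm v f).toReal * v x :=
  (sobNorm_le_ofReal_iff hv ENNReal.toReal_nonneg).1 (ENNReal.ofReal_toReal hf.2.ne).ge

theorem Lv1_subset_Lv : Lv1 v ⊆ Lv v := fun _ hf =>
  ⟨hf.1.continuous.measurable, (le_max_left _ _).trans_lt hf.2⟩

theorem eq_zero_of_vNorm_eq_zero (hv : ∀ x, 1 ≤ v x) (hf : vNorm v f = 0) : f = 0 := by
  funext x
  have h := (vNorm_le_ofReal_iff (f := f) hv le_rfl).1 (by simp [hf]) x
  simpa using h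

theorem sobNorm_zero : sobNorm v (0 : State ℓ → ℝ) = 0 := by
  have h (i : Fin ℓ) : partialDeriv i (0 : State ℓ → ℝ) = 0 := by
    funext x; simp [partialDeriv]
  simp [sobNorm, vNorm, h]

theorem partialDeriv_sub_const (i : Fin ℓ) (f : State ℓ → ℝ) (c : ℝ) :
    partialDeriv i (fun x => f x - c) = partialDeriv i f := by
  funext x
  simp [partialDeriv, fderiv_sub_const]

/-- The norm of the derivative is controlled by the partial derivatives. -/
theorem norm_fderiv_le (x : State ℓ) (hM : ∀ i, |partialDeriv i f x| ≤ M) :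
    ‖fderiv ℝ f x‖ ≤ ℓ * M := by
  have hM0 : 0 ≤ (ℓ : ℝ) * M := by
    rcases Nat.eq_zero_or_pos ℓ with rfl | h
    · simp
    · exact mul_nonneg (Nat.cast_nonneg _) ((abs_nonneg _).trans (hM ⟨0, h⟩))
  refine ContinuousLinearMap.opNorm_le_bound _ hM0 fun y => ?_
  have hy : y = ∑ i, y i • EuclideanSpace.single i (1 : ℝ) := by
    ext j
    simp [Finset.sum_apply, Pi.single_apply]
  calc ‖fderiv ℝ f x y‖ = ‖∑ i, y i * partialDeriv i f x‖ := by
        conv_lhs => rw [hy]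
        simp [partialDeriv]
    _ ≤ ∑ i, ‖y i * partialDeriv i f x‖ := norm_sum_le _ _
    _ ≤ ∑ _i : Fin ℓ, ‖y‖ * M := by
        refine Finset.sum_le_sum fun i _ => ?_
        rw [norm_mul]
        exact mul_le_mul (PiLp.norm_apply_le y i) (hM i) (norm_nonneg _) (norm_nonneg _)
    _ = ℓ * M * ‖y‖ := by simp; ring

theorem sobNorm_apply_le (hv : ∀ x, 1 ≤ v x) {A : (State ℓ → ℝ) → (State ℓ → ℝ)} (hA : A 0 = 0)
    (hf : f ∈ Lv1 v) : sobNorm v (A f) ≤ opNorm v A * sobNorm v f := by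
  -- The supremum omits norm zero; there `f = 0`, and `hA` settles the case.
  by_cases h : sobNorm v f = 0
  · have hf0 : f = 0 := eq_zero_of_vNorm_eq_zero hv (le_zero_iff.1 (h ▸ le_max_left _ _))
    rw [hf0, hA, sobNorm_zero]
    exact zero_le
  · refine (ENNReal.div_le_iff h hf.2.ne).1 ?_
    exact le_iSup₂ (f := fun g (_ : g ∈ {f | f ∈ Lv1 v ∧ sobNorm v f ≠ 0}) =>
      sobNorm v (A g) / sobNorm v g) f ⟨hf, h⟩

theorem sobNorm_apply_le_of_opNorm_le (hv : ∀ x, 1 ≤ v x)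
    {A : (State ℓ → ℝ) → (State ℓ → ℝ)} (hA : A 0 = 0) {C : ℝ} (hC : 0 ≤ C)
    (hAC : opNorm v A ≤ ENNReal.ofReal C) (hf : f ∈ Lv1 v)
    (hfM : sobNorm v f ≤ ENNReal.ofReal M) : sobNorm v (A f) ≤ ENNReal.ofReal (C * M) := by
  rw [ENNReal.ofReal_mul hC]
  exact (sobNorm_apply_le hv hA hf).trans (mul_le_mul' hAC hfM)

theorem opNorm_le_ofReal {A : (State ℓ → ℝ) → (State ℓ → ℝ)} {C : ℝ}
    (h : ∀ f ∈ Lv1 v, sobNorm v (A f) ≤ ENNReal.ofReal (C * (sobNorm v f).toReal)) :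
    opNorm v A ≤ ENNReal.ofReal C := by
  refine iSup₂_le fun f hf => ?_
  rw [ENNReal.div_le_iff hf.2 hf.1.2.ne]
  refine (h f hf.1).trans_eq ?_
  rw [ENNReal.ofReal_mul' ENNReal.toReal_nonneg, ENNReal.ofReal_toReal hf.1.2.ne]

end Norms

/-! ### Finite-rank and separable operators. -/

section FiniteRank

variable {ℓ : ℕ} {v : State ℓ → ℝ} {f : State ℓ → ℝ}

theorem signedIntegral_zero (ν : SignedMeasure (State ℓ)) : signedIntegral ν 0 = 0 :=
  VectorMeasure.integral_zero

theorem abs_signedIntegral_le (hv : ∀ x, 1 ≤ v x) {ν : SignedMeasure (State ℓ)} (hν : ν ∈ M1v v)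
    (hf : f ∈ Lv v) {M : ℝ} (hM : 0 ≤ M) (hfM : vNorm v f ≤ ENNReal.ofReal M) :
    |signedIntegral ν f| ≤ (signedVNorm v ν).toReal * M := by
  by_cases h : vNorm v f = 0
  · rw [eq_zero_of_vNorm_eq_zero hv h, signedIntegral_zero, abs_zero]
    positivity
  · rw [← ENNReal.ofReal_le_ofReal_iff (by positivity), ENNReal.ofReal_mul (by positivity),
      ENNReal.ofReal_toReal hν.2.ne]
    refine le_trans ?_ (mul_le_mul' le_rfl hfM)
    refine (ENNReal.div_le_iff h hf.2.ne).1 ?_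
    exact le_iSup₂ (f := fun g (_ : g ∈ {f | f ∈ Lv v ∧ vNorm v f ≠ 0}) =>
      ENNReal.ofReal |signedIntegral ν g| / vNorm v g) f ⟨hf, h⟩

theorem IsFiniteRank.map_zero {T : (State ℓ → ℝ) → (State ℓ → ℝ)} (hT : IsFiniteRank v T) :
    T 0 = 0 := by
  obtain ⟨N, m, s, ν, -, -, rfl⟩ := hT
  funext x
  simp [finiteRankOp, signedIntegral_zero]

/-- A finite-rank operator is bounded from the weighted sup-norm to the weighted Sobolev norm. -/
theorem IsFiniteRank.exists_bound (hv : ∀ x, 1 ≤ v x) {T : (State ℓ → ℝ) → (State ℓ → ℝ)}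
    (hT : IsFiniteRank v T) :
    ∃ C : ℝ, 0 ≤ C ∧ ∀ f ∈ Lv v, Differentiable ℝ (T f) ∧ ∀ M : ℝ, 0 ≤ M →
      vNorm v f ≤ ENNReal.ofReal M → sobNorm v (T f) ≤ ENNReal.ofReal (C * M) := by
  obtain ⟨N, m, s, ν, hs, hν, rfl⟩ := hT
  refine ⟨∑ i, ∑ j, |m i j| * (sobNorm v (s i)).toReal * (signedVNorm v (ν j)).toReal,
    by positivity, fun f hf => ?_⟩
  have hds (i : Fin N) : Differentiable ℝ (s i) := (hs i).1.differentiable one_ne_zero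
  have hd (x : State ℓ) : HasFDerivAt (finiteRankOp m s ν f)
      (∑ i, ∑ j, signedIntegral (ν j) f • m i j • fderiv ℝ (s i) x) x := by
    refine HasFDerivAt.fun_sum fun i _ => HasFDerivAt.fun_sum fun j _ => ?_
    exact ((hds i x).hasFDerivAt.const_mul (m i j)).mul_const (signedIntegral (ν j) f)
  refine ⟨fun x => (hd x).differentiableAt, fun M hM hfM => ?_⟩
  rw [sobNorm_le_ofReal_iff hv (by positivity)]
  -- Since `ν_j(f)` does not depend on `x`, one estimate serves both `T f` (with `a i = s i x`) and
  -- its partial derivatives (with `a i = ∂_k s_i(x)`).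
  have key (a : Fin N → ℝ) (x : State ℓ) (ha : ∀ i, |a i| ≤ (sobNorm v (s i)).toReal * v x) :
      |∑ i, ∑ j, m i j * a i * signedIntegral (ν j) f| ≤
        (∑ i, ∑ j, |m i j| * (sobNorm v (s i)).toReal * (signedVNorm v (ν j)).toReal) * M *
          v x := by
    simp only [Finset.sum_mul]
    refine (Finset.abs_sum_le_sum_abs _ _).trans (Finset.sum_le_sum fun i _ =>
      (Finset.abs_sum_le_sum_abs _ _).trans (Finset.sum_le_sum fun j _ => ?_))
    rw [abs_mul, abs_mul]
    calc |m i j| * |a i| * |signedIntegral (ν j) f|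
        ≤ |m i j| * ((sobNorm v (s i)).toReal * v x) * ((signedVNorm v (ν j)).toReal * M) := by
          have := zero_le_one.trans (hv x)
          gcongr
          · exact ha i
          · exact abs_signedIntegral_le hv (hν j) hf hM hfM
      _ = _ := by ring
  refine ⟨fun x => key (fun i => s i x) x fun i => (bounds_of_mem_Lv1 hv (hs i)).1 x,
    fun k x => ?_⟩
  refine le_of_eq_of_le (congrArg abs ?_)
    (key (fun i => partialDeriv k (s i) x) x fun i => (bounds_of_mem_Lv1 hv (hs i)).2 k x)
  rw [partialDeriv, (hd x).fderiv]
  simp only [sum_apply, smul_apply, smul_eq_mul,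
    partialDeriv]
  exact Finset.sum_congr rfl fun i _ => Finset.sum_congr rfl fun j _ => by ring

/-- A separable operator satisfies a Doeblin-Fortet inequality with arbitrarily small leading
constant. -/
theorem IsSeparableOp.exists_bound (hv : ∀ x, 1 ≤ v x) {A : (State ℓ → ℝ) → (State ℓ → ℝ)}
    (hA : IsSeparableOp v A) (hA0 : A 0 = 0) {ε : ℝ} (hε : 0 < ε) :
    ∃ C : ℝ, 0 ≤ C ∧ ∀ f ∈ Lv1 v, ∀ K M : ℝ, 0 ≤ K → 0 ≤ M →
      sobNorm v f ≤ ENNReal.ofReal K → vNorm v f ≤ ENNReal.ofReal M →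
      sobNorm v (A f) ≤ ENNReal.ofReal (ε * K + C * M) := by
  obtain ⟨T, hT, hAT⟩ := hA.2 ε hε
  obtain ⟨C, hC, hTC⟩ := hT.exists_bound hv
  refine ⟨C, hC, fun f hf K M hK hM hfK hfM => ?_⟩
  obtain ⟨hTd, hTb⟩ := hTC f (Lv1_subset_Lv hf)
  have hAd : Differentiable ℝ (A f) := (hA.1 hf).1.differentiable one_ne_zero
  have h1 := sobNorm_apply_le_of_opNorm_le (A := fun f x => A f x - T f x) hv
    (by funext x; simp [hA0, hT.map_zero]) hε.le hAT hf hfK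
  have h2 := hTb M hM hfM
  rw [sobNorm_le_ofReal_iff hv (by positivity)] at h1 h2 ⊢
  constructor
  · intro x
    have := abs_add_le (A f x - T f x) (T f x)
    rw [sub_add_cancel] at this
    linarith [h1.1 x, h2.1 x]
  · intro i x
    have hsub : partialDeriv i (fun x => A f x - T f x) x
        = partialDeriv i (A f) x - partialDeriv i (T f) x := by
      simp [partialDeriv, fderiv_fun_sub (hAd x) (hTd x)]
    have := abs_add_le (partialDeriv i (A f) x - partialDeriv i (T f) x) (partialDeriv i (T f) x)
    rw [sub_add_cancel, ← hsub] at this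
    linarith [h1.2 i x, h2.2 i x]

end FiniteRank

/-! ### Termwise differentiation of series. -/

section Series

variable {ℓ : ℕ} {v : State ℓ → ℝ}

/-- Absolutely convergent series in the weighted Sobolev space converge, together with their
derivatives. -/
theorem exists_hasSum_of_summable_sobNorm (hvc : Continuous v) (hv : ∀ x, 1 ≤ v x)
    {g : ℕ → State ℓ → ℝ} (hg : ∀ t, g t ∈ Lv1 v)
    (hsum : Summable fun t => (sobNorm v (g t)).toReal) :
    ∃ h ∈ Lv1 v, (∀ x, HasSum (fun t => g t x) (h x)) ∧
      ∀ x, HasSum (fun t => fderiv ℝ (g t) x) (fderiv ℝ h x) := by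
  have hb := fun t => bounds_of_mem_Lv1 hv (hg t)
  have hsumx (c : ℝ) : Summable fun t => (sobNorm v (g t)).toReal * c := hsum.mul_right c
  have hs0 (x : State ℓ) : Summable fun t => g t x :=
    (hsumx (v x)).of_norm_bounded fun t => (hb t).1 x
  have hfd (t : ℕ) (x : State ℓ) : ‖fderiv ℝ (g t) x‖ ≤ (sobNorm v (g t)).toReal * (ℓ * v x) := by
    refine (norm_fderiv_le x fun i => (hb t).2 i x).trans_eq (by ring)
  have hs1 (x : State ℓ) : Summable fun t => fderiv ℝ (g t) x :=
    (hsumx _).of_norm_bounded fun t => hfd t x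
  -- The derivative bounds grow with `v`, hence are uniform only locally; this suffices, as
  -- differentiability and continuity are local.
  have hball (x : State ℓ) : ∃ R : ℝ, ∀ y ∈ Metric.ball x 1, v y ≤ R := by
    obtain ⟨R, hR⟩ := (isCompact_closedBall x 1).exists_bound_of_continuousOn hvc.continuousOn
    exact ⟨R, fun y hy => (le_abs_self _).trans (hR y (Metric.ball_subset_closedBall hy))⟩
  have hderiv (x : State ℓ) :
      HasFDerivAt (fun y => ∑' t, g t y) (∑' t, fderiv ℝ (g t) x) x := by
    obtain ⟨R, hR⟩ := hball x
    refine hasFDerivAt_tsum_of_isPreconnected (s := Metric.ball x 1) (hsumx (ℓ * R))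
      Metric.isOpen_ball (convex_ball x 1).isPreconnected
      (fun t y _ => ((hg t).1.differentiable one_ne_zero y).hasFDerivAt)
      (fun t y hy => (hfd t y).trans ?_) (Metric.mem_ball_self one_pos) (hs0 x)
      (Metric.mem_ball_self one_pos)
    have := hR y hy
    gcongr
  have hfderiv : fderiv ℝ (fun y => ∑' t, g t y) = fun x => ∑' t, fderiv ℝ (g t) x :=
    funext fun x => (hderiv x).fderiv
  have hcont : Continuous fun x => ∑' t, fderiv ℝ (g t) x := by
    refine continuous_iff_continuousAt.2 fun x => ?_
    obtain ⟨R, hR⟩ := hball x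
    refine (continuousOn_tsum (s := Metric.ball x 1)
      (fun t => ((hg t).1.continuous_fderiv one_ne_zero).continuousOn) (hsumx (ℓ * R))
      fun t y hy => (hfd t y).trans ?_).continuousAt (Metric.ball_mem_nhds x one_pos)
    have := hR y hy
    gcongr
  have habs {a : ℕ → ℝ} {x : State ℓ} (ha : ∀ t, |a t| ≤ (sobNorm v (g t)).toReal * v x) :
      |∑' t, a t| ≤ (∑' t, (sobNorm v (g t)).toReal) * v x := by
    rw [← tsum_mul_right]
    exact tsum_of_norm_bounded (f := a) (hsumx (v x)).hasSum ha
  refine ⟨fun y => ∑' t, g t y, ⟨?_, ?_⟩, fun x => (hs0 x).hasSum, fun x => ?_⟩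
  · rw [contDiff_one_iff_fderiv, hfderiv]
    exact ⟨fun x => (hderiv x).differentiableAt, hcont⟩
  · refine lt_of_le_of_lt ((sobNorm_le_ofReal_iff (M := ∑' t, (sobNorm v (g t)).toReal) hv
      (tsum_nonneg fun _ => ENNReal.toReal_nonneg)).2 ⟨fun x => habs fun t => (hb t).1 x,
        fun i x => ?_⟩) ENNReal.ofReal_lt_top
    have : partialDeriv i (fun y => ∑' t, g t y) x = ∑' t, partialDeriv i (g t) x := by
      rw [partialDeriv, hfderiv]
      exact (ContinuousLinearMap.apply ℝ ℝ (EuclideanSpace.single i (1 : ℝ))).map_tsum (hs1 x)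
    rw [this]
    exact habs fun t => (hb t).2 i x
  · rw [hfderiv]
    exact (hs1 x).hasSum

end Series

/-! ### Centered iterates and Poisson's equation. -/

section Chain

variable {ℓ : ℕ} {v : State ℓ → ℝ} {f : State ℓ → ℝ}
  {P : Kernel (State ℓ) (State ℓ)} {π : Measure (State ℓ)}

theorem isMarkovKernel_pow [IsMarkovKernel P] (t : ℕ) : IsMarkovKernel (P ^ t) := by
  induction t with
  | zero => exact inferInstanceAs (IsMarkovKernel Kernel.id)
  | succ t ih =>
    rw [Kernel.pow_add, pow_one]
    infer_instance

theorem kernelOp_pow_zero (hf : Measurable f) : kernelOp (P ^ 0) f = f := by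
  funext x
  change ∫ y, f y ∂(Kernel.id x) = f x
  rw [Kernel.id_apply]
  exact integral_dirac' f x hf.stronglyMeasurable

theorem kernelOp_zero : kernelOp P 0 = 0 := by
  funext x
  simp [kernelOp]

theorem partialDeriv_centeredOp (i : Fin ℓ) (t : ℕ) :
    partialDeriv i (centeredOp P π t f) = partialDeriv i (kernelOp (P ^ t) f) :=
  partialDeriv_sub_const i _ _

theorem fderiv_centeredOp (t : ℕ) (x : State ℓ) :
    fderiv ℝ (centeredOp P π t f) x = fderiv ℝ (kernelOp (P ^ t) f) x :=
  fderiv_sub_const (f := kernelOp (P ^ t) f) _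

theorem integrable_kernelOp_pow {s t : ℕ} {x : State ℓ} (hf : Integrable f ((P ^ (s + t)) x)) :
    Integrable (kernelOp (P ^ s) f) ((P ^ t) x) := by
  rw [Kernel.pow_add] at hf
  exact hf.integral_comp

/-- The semigroup property of the centered transition operators. -/
theorem kernelOp_centeredOp [IsMarkovKernel P] {s t : ℕ} {x : State ℓ}
    (hf : Integrable f ((P ^ (s + t)) x)) :
    kernelOp (P ^ t) (centeredOp P π s f) x = centeredOp P π (s + t) f x := by
  have := isMarkovKernel_pow (P := P) t
  have hi := integrable_kernelOp_pow hf
  have h : kernelOp (P ^ (s + t)) f x = kernelOp (P ^ t) (kernelOp (P ^ s) f) x := by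
    simp only [kernelOp]
    rw [Kernel.pow_add] at hf ⊢
    exact Kernel.integral_comp hf
  rw [centeredOp, h]
  refine (integral_sub hi (integrable_const _)).trans ?_
  simp [kernelOp]

/-- A nonnegative form of the ergodicity bound. -/
theorem IsVUniformlyErgodic.exists_bound (hv : ∀ x, 1 ≤ v x) (h : IsVUniformlyErgodic v P π) :
    ∃ b ρ : ℝ, 0 ≤ b ∧ 0 < ρ ∧ ρ < 1 ∧ ∀ f ∈ Lv v, ∀ M : ℝ, 0 ≤ M →
      vNorm v f ≤ ENNReal.ofReal M → ∀ t x, |centeredOp P π t f x| ≤ b * ρ ^ t * M * v x := by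
  obtain ⟨b, ρ, hρ0, hρ1, hb⟩ := h.bound
  refine ⟨|b|, ρ, abs_nonneg b, hρ0, hρ1, fun f hf M hM hfM t x => (hb f hf t x).trans ?_⟩
  have hM' : (vNorm v f).toReal ≤ M := ENNReal.toReal_le_of_le_ofReal hM hfM
  have := zero_le_one.trans (hv x)
  have := le_abs_self b
  gcongr

theorem centeredOp_mem_Lv1 (hv : ∀ x, 1 ≤ v x) (h : IsVUniformlyErgodic v P π) {t : ℕ}
    (hP : Set.MapsTo (kernelOp (P ^ t)) (Lv1 v) (Lv1 v)) (hf : f ∈ Lv1 v) :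
    centeredOp P π t f ∈ Lv1 v := by
  obtain ⟨b, ρ, hb, hρ0, -, hbd⟩ := h.exists_bound hv
  have hfv := Lv1_subset_Lv hf
  refine ⟨(hP hf).1.sub contDiff_const, max_lt ?_ ?_⟩
  · refine lt_of_le_of_lt ((vNorm_le_ofReal_iff hv (M := b * ρ ^ t * (vNorm v f).toReal)
      (by positivity)).2 ?_) ENNReal.ofReal_lt_top
    exact hbd f hfv _ ENNReal.toReal_nonneg (ENNReal.ofReal_toReal hfv.2.ne).ge t
  · simp only [partialDeriv_centeredOp]
    exact (le_max_right _ _).trans_lt (hP hf).2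

/-- Geometric convergence in the weighted Sobolev norm, by iterating the Doeblin-Fortet
inequality. -/
theorem exists_sobNorm_centeredOp_le [IsMarkovKernel P] (hv : ∀ x, 1 ≤ v x)
    (herg : IsVUniformlyErgodic v P π) {t₁ : ℕ} (ht₁ : 1 ≤ t₁)
    (hbdd : ∀ t : ℕ, t₁ ≤ t → IsBoundedOn v (kernelOp (P ^ t)))
    (hsep : IsSeparableOp v (kernelOp (P ^ t₁))) :
    ∃ K ρ : ℝ, 0 ≤ K ∧ 0 < ρ ∧ ρ < 1 ∧ ∀ f ∈ Lv1 v, ∀ M : ℝ, 0 ≤ M →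
      sobNorm v f ≤ ENNReal.ofReal M → ∀ t, t₁ ≤ t →
      sobNorm v (centeredOp P π t f) ≤ ENNReal.ofReal (K * ρ ^ t * M) := by
  obtain ⟨b, ρ, hb, hρ0, hρ1, hbd⟩ := herg.exists_bound hv
  obtain ⟨C, hC, hDF⟩ := hsep.exists_bound hv kernelOp_zero (ε := ρ ^ t₁ / 2) (by positivity)
  set N : ℕ → ℝ := fun t => (opNorm v (kernelOp (P ^ t))).toReal
  have hN0 (t : ℕ) : 0 ≤ N t := ENNReal.toReal_nonneg
  -- The sum pays for the base cases `t₁ ≤ t < 2 t₁`; the last term ensures `C b ≤ K ρ^{t₁}/2`, the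
  -- half of the budget left over by `ε`.
  set K : ℝ := ∑ t ∈ Finset.range (2 * t₁), (b + N t / ρ ^ t) + 2 * C * b / ρ ^ t₁
  have hK0 : 0 ≤ K := by positivity
  refine ⟨K, ρ, hK0, hρ0, hρ1, fun f hf M hM hfM t => ?_⟩
  have hfv := (le_max_left _ _).trans hfM
  have hbdf := hbd f (Lv1_subset_Lv hf) M hM hfv
  induction t using Nat.strong_induction_on with
  | _ t ih =>
  intro ht
  rcases lt_or_ge t (2 * t₁) with h2 | h2
  · have hKt : b + N t / ρ ^ t ≤ K := by
      have := Finset.single_le_sum (f := fun t => b + N t / ρ ^ t)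
        (fun t _ => by positivity) (Finset.mem_range.2 h2)
      have : 0 ≤ 2 * C * b / ρ ^ t₁ := by positivity
      linarith
    have hKt' : b * ρ ^ t + N t ≤ K * ρ ^ t := by
      have := mul_le_mul_of_nonneg_right hKt (pow_pos hρ0 t).le
      rwa [add_mul, div_mul_cancel₀ _ (pow_pos hρ0 t).ne'] at this
    have hbN : 0 ≤ b * ρ ^ t := by positivity
    have hP := sobNorm_apply_le_of_opNorm_le hv kernelOp_zero (hN0 t)
      (ENNReal.ofReal_toReal (hbdd t ht).2.ne).ge hf hfM
    rw [sobNorm_le_ofReal_iff hv (mul_nonneg (hN0 t) hM)] at hP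
    rw [sobNorm_le_ofReal_iff hv (by positivity)]
    constructor
    · intro x
      have := zero_le_one.trans (hv x)
      refine (hbdf t x).trans ?_
      exact mul_le_mul_of_nonneg_right (mul_le_mul_of_nonneg_right (by linarith [hN0 t]) hM) this
    · intro i x
      have := zero_le_one.trans (hv x)
      rw [partialDeriv_centeredOp]
      refine (hP.2 i x).trans ?_
      gcongr
      linarith
  -- From `2 t₁` on, `s ≥ t₁`, so `Q_s f` is known to lie in `L_∞^{v,1}`.
  · obtain ⟨s, rfl⟩ : ∃ s, t = s + t₁ := ⟨t - t₁, by omega⟩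
    have hs : t₁ ≤ s := by omega
    have hstep : centeredOp P π (s + t₁) f = kernelOp (P ^ t₁) (centeredOp P π s f) :=
      funext fun x => (kernelOp_centeredOp ((herg.integrable f (Lv1_subset_Lv hf)).2 _ x)).symm
    rw [hstep]
    refine (hDF _ (centeredOp_mem_Lv1 hv herg (hbdd s hs).1 hf) (K * ρ ^ s * M) (b * ρ ^ s * M)
      (by positivity) (by positivity) (ih s (by omega) hs)
      ((vNorm_le_ofReal_iff hv (by positivity)).2 (hbdf s))).trans ?_
    refine ENNReal.ofReal_le_ofReal ?_
    have hCK : C * b ≤ K * (ρ ^ t₁ / 2) := by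
      have : 2 * C * b / ρ ^ t₁ ≤ K :=
        le_add_of_nonneg_left (Finset.sum_nonneg fun t _ => by positivity)
      rw [div_le_iff₀ (by positivity)] at this
      linarith
    have := mul_le_mul_of_nonneg_right hCK (show 0 ≤ ρ ^ s * M by positivity)
    rw [pow_add]
    linarith

/-- The sum of the centered iterates solves Poisson's equation. -/
theorem sub_kernelOp_eq_of_hasSum [IsMarkovKernel P] (hvc : Continuous v) (hv : ∀ x, 1 ≤ v x)
    (herg : IsVUniformlyErgodic v P π) {c h : State ℓ → ℝ} (hc : c ∈ Lv v)
    (hh : ∀ x, HasSum (fun t => centeredOp P π t c x) (h x)) (x : State ℓ) :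
    h x - kernelOp P h x = c x - ∫ y, c y ∂π := by
  obtain ⟨b, ρ, hb, hρ0, hρ1, hbd⟩ := herg.exists_bound hv
  set M := (vNorm v c).toReal
  have hbdc := hbd c hc M ENNReal.toReal_nonneg (ENNReal.ofReal_toReal hc.2.ne).ge
  -- Thus `v` is `P(x, ·)`-integrable, and a multiple of it dominates the series.
  have hvL : v ∈ Lv v := by
    refine ⟨hvc.measurable, lt_of_le_of_lt ((vNorm_le_ofReal_iff hv zero_le_one).2 fun x => ?_)
      ENNReal.ofReal_lt_top⟩
    rw [one_mul, abs_of_nonneg (zero_le_one.trans (hv x))]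
  have hgeo (a : ℝ) : Summable fun t : ℕ => b * ρ ^ t * M * a :=
    (((summable_geometric_of_lt_one hρ0.le hρ1).mul_left b).mul_right M).mul_right a
  have hvi : Integrable v (P x) := by simpa using (herg.integrable v hvL).2 1 x
  have hci (t : ℕ) : Integrable c ((P ^ t) x) := (herg.integrable c hc).2 t x
  have hint : HasSum (fun t => ∫ y, centeredOp P π t c y ∂(P x)) (∫ y, h y ∂(P x)) := by
    refine hasSum_integral_of_dominated_convergence (fun t y => b * ρ ^ t * M * v y)
      (fun t => ?_) (fun t => .of_forall (hbdc t)) (.of_forall fun y => hgeo (v y)) ?_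
      (.of_forall hh)
    · have := integrable_kernelOp_pow (hci (t + 1))
      rw [pow_one] at this
      exact (this.sub (integrable_const _)).aestronglyMeasurable
    · simp only [tsum_mul_right]
      exact hvi.const_mul _
  have hshift : HasSum (fun t => centeredOp P π (t + 1) c x) (kernelOp P h x) := by
    refine hint.congr_fun fun t => ?_
    have := kernelOp_centeredOp (π := π) (hci (t + 1))
    rw [pow_one] at this
    exact this.symm
  have h0 : centeredOp P π 0 c x = c x - ∫ y, c y ∂π := by
    rw [centeredOp, kernelOp_pow_zero hc.1]
  -- `P` shifts the series by one index, so `h - P h` is its term at `t = 0`.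
  have := (hasSum_nat_add_iff' 1).2 (hh x)
  rw [Finset.sum_range_one, h0] at this
  linarith [this.unique hshift]

end Chain

end WeightedSobolev

end

theorem theorem3p3 {ℓ : ℕ}
    (P : ProbabilityTheory.Kernel (WeightedSobolev.State ℓ) (WeightedSobolev.State ℓ))
    [ProbabilityTheory.IsMarkovKernel P]
    (π : MeasureTheory.Measure (WeightedSobolev.State ℓ))
    (v : WeightedSobolev.State ℓ → ℝ) (hv : Continuous v) (hv1 : ∀ x, 1 ≤ v x)
    (herg : WeightedSobolev.IsVUniformlyErgodic v P π)
    (t₁ : ℕ) (ht₁ : 1 ≤ t₁)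
    (hbdd : ∀ t : ℕ, t₁ ≤ t → WeightedSobolev.IsBoundedOn v (WeightedSobolev.kernelOp (P ^ t)))
    (hsep : WeightedSobolev.IsSeparableOp v (WeightedSobolev.kernelOp (P ^ t₁))) :
    (∃ b₀ ϱ₀ : ℝ, 0 < ϱ₀ ∧ ϱ₀ < 1 ∧ ∀ t : ℕ, t₁ ≤ t →
      Set.MapsTo (WeightedSobolev.centeredOp P π t)
        (WeightedSobolev.Lv1 v) (WeightedSobolev.Lv1 v) ∧
      WeightedSobolev.opNorm v (WeightedSobolev.centeredOp P π t) ≤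
        ENNReal.ofReal (b₀ * ϱ₀ ^ t)) ∧
    ((∀ t : ℕ, 1 ≤ t → WeightedSobolev.IsBoundedOn v (WeightedSobolev.kernelOp (P ^ t))) →
      ∀ c ∈ WeightedSobolev.Lv1 v, ∃ h ∈ WeightedSobolev.Lv1 v,
        (∀ x, h x - WeightedSobolev.kernelOp P h x = c x - ∫ y, c y ∂π) ∧
        ∀ x, HasSum (fun t : ℕ => gradient (WeightedSobolev.kernelOp (P ^ t) c) x)
          (gradient h x)) := by
  open WeightedSobolev in
  obtain ⟨K, ρ, hK, hρ0, hρ1, hbd⟩ := exists_sobNorm_centeredOp_le hv1 herg ht₁ hbdd hsep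
  have hself {f : State ℓ → ℝ} (hf : f ∈ Lv1 v) :=
    hbd f hf _ ENNReal.toReal_nonneg (ENNReal.ofReal_toReal hf.2.ne).ge
  refine ⟨⟨K, ρ, hρ0, hρ1, fun t ht =>
    ⟨fun f hf => centeredOp_mem_Lv1 hv1 herg (hbdd t ht).1 hf,
      opNorm_le_ofReal fun f hf => hself hf t ht⟩⟩, fun hall c hc => ?_⟩
  have hmem (t : ℕ) : centeredOp P π t c ∈ Lv1 v := by
    refine centeredOp_mem_Lv1 hv1 herg ?_ hc
    rcases Nat.eq_zero_or_pos t with rfl | ht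
    · intro f hf
      rwa [kernelOp_pow_zero hf.1.continuous.measurable]
    · exact (hall t ht).1
  have hsum : Summable fun t => (sobNorm v (centeredOp P π t c)).toReal := by
    -- The geometric bound holds only from `t₁` on; finitely many earlier terms do not matter.
    rw [← summable_nat_add_iff t₁]
    refine Summable.of_nonneg_of_le (fun _ => ENNReal.toReal_nonneg)
      (fun t => ENNReal.toReal_le_of_le_ofReal (by positivity) (hself hc (t + t₁) (by omega))) ?_
    refine Summable.mul_right _ (Summable.mul_left K ?_)
    exact (summable_nat_add_iff t₁).2 (summable_geometric_of_lt_one hρ0.le hρ1)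
  obtain ⟨h, hh, hsum0, hsum1⟩ := exists_hasSum_of_summable_sobNorm hv hv1 hmem hsum
  refine ⟨h, hh, sub_kernelOp_eq_of_hasSum hv hv1 herg (Lv1_subset_Lv hc) hsum0, fun x => ?_⟩
  have := hsum1 x
  simp only [fderiv_centeredOp] at this
  -- The Riesz isometry turns derivatives into gradients.
  exact this.map (InnerProductSpace.toDual ℝ (State ℓ)).symm
    (InnerProductSpace.toDual ℝ (State ℓ)).symm.continuous
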